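/- Consider the frog model on $\mathbb{Z}$ with one frog at each site $j\in\{0,1,2,\dots\}$ and no frogs at negative sites. At time $0$ the frog at the origin is active and the frogs at the sites $j\ge 1$ are asleep. A sleeping frog becomes active when an active frog lands on its site. Once active, the frog that started at $j$ performs a discrete-time nearest-neighbour random walk on $\mathbb{Z}$ from $j$, which steps left with probability $p_j$ and right with probability $1-p_j$, where $\tfrac12<p_j<1$ for every $j\ge 0$; all steps of all frogs are independent. The model is called transient if the probability that infinitely many distinct frogs hit the origin is $0$. Let $C$ be a real number and suppose that $p_n=\tfrac12+\dfrac{C}{\log n}$ for all but finitely many $n$. Then the model is transient if and only if $C\ge \dfrac{\pi^2}{24}$. Moreover, the constant $\mathcal{K}=\int_0^\infty\bigl|\log(1-e^{-x})\bigr|\,dx$ is finite and equals $\dfrac{\pi^2}{6}$, so that the critical value $\pi^2/24$ is $\mathcal{K}/4$. -/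

import Mathlib

namespace Frog

open MeasureTheory ProbabilityTheory

/-- The driving randomness on a probability space `(Ω, μ)`: `ξ j k` is the displacement in the
`(k+1)`-st step that frog `j` makes once it is active. All steps of all frogs are independent, and
every step of frog `j` is `-1` with probability `p j` and `+1` with probability `1 - p j`. -/
structure IsStepFamily {Ω : Type*} [MeasurableSpace Ω] (μ : Measure Ω) (p : ℕ → ℝ)
    (ξ : ℕ → ℕ → Ω → ℤ) : Prop where
  measurable : ∀ j k, Measurable (ξ j k)
  left : ∀ j k, μ {ω | ξ j k ω = -1} = ENNReal.ofReal (p j)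
  right : ∀ j k, μ {ω | ξ j k ω = 1} = ENNReal.ofReal (1 - p j)
  indep : iIndepFun (fun i : ℕ × ℕ => ξ i.1 i.2) μ

/-- The position of frog `j`, which starts at site `j`, after it has made `k` steps; here `x j i`
is its `(i+1)`-st step. -/
def walk (x : ℕ → ℕ → ℤ) (j k : ℕ) : ℤ := (j : ℤ) + ∑ i ∈ Finset.range k, x j i

/-- A configuration of the frog model with one frog per site of `ℕ`: the set of awake (active)
frogs, and the number of steps that each frog has made so far. Frogs are labelled by the site at
which they start. -/
structure State where
  awake : Set ℕ
  steps : ℕ → ℕ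

open Classical in
/-- The evolution in discrete time. At time `0` only frog `0`, at the origin, is awake. In each unit
of time every awake frog makes the next step of its walk, and then every frog asleep at a site on
which an awake frog has just landed wakes up (it starts moving in the next unit of time). There are
no frogs at the negative sites. -/
noncomputable def state (x : ℕ → ℕ → ℤ) : ℕ → State
  | 0 => ⟨{0}, fun _ => 0⟩
  | t + 1 =>
    let s := state x t
    let n : ℕ → ℕ := fun j => if j ∈ s.awake then s.steps j + 1 else s.steps j
    ⟨s.awake ∪ {i : ℕ | ∃ j ∈ s.awake, walk x j (n j) = (i : ℤ)}, n⟩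

/-- Frog `j` hits the origin: at some time it is awake and sits at `0`. -/
def HitsOrigin (x : ℕ → ℕ → ℤ) (j : ℕ) : Prop :=
  ∃ t : ℕ, j ∈ (state x t).awake ∧ walk x j ((state x t).steps j) = 0

/-- The model is transient if the probability that infinitely many frogs hit the origin is `0`. -/
def Transient {Ω : Type*} [MeasurableSpace Ω] (μ : Measure Ω) (ξ : ℕ → ℕ → Ω → ℤ) : Prop :=
  μ {ω | {j : ℕ | HitsOrigin (fun i k => ξ i k ω) j}.Infinite} = 0

end Frog

namespace Frog

open MeasureTheory ProbabilityTheory Filter Topology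

/-! ### Dynamics of the awake set -/

/-! When a frog wakes does not matter, only where its walk goes. If some site `n ≥ 1` lies out of
reach of all frogs `j < n`, only frogs below `n` ever wake. Otherwise all frogs wake, and the left
drift takes each of them to the origin almost surely. So transience means `μ (allReached ξ) = 0`
(`transient_iff`).

By gambler's ruin frog `j` climbs `m` sites with probability `odds p j ^ m`, and by independence
site `n` is missed with probability `∏ (1 - odds p j ^ (n - j))`. Near `n` the odds are about `exp
(-a)` with `a = 4C / log n`, and `∑ -log (1 - exp (-a m))` is about `(π²/6) / a`, so the product
behaves like `n ^ (-π² / (24 C))` up to lower-order terms in the exponent.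

If `C < π²/24` this is summable: with positive probability frog `0` covers an initial stretch and,
independently, the other frogs cover the rest. If `C ≥ π²/24`, error-free inequalities bound the
product below by `1 / n`, which settles the critical case too. The events of missing a site are
dependent, so Borel–Cantelli is replaced by a renewal argument, which rests on the odds being
eventually monotone. -/

theorem awake_subset_of_walk_lt {x : ℕ → ℕ → ℤ} {n : ℕ} (hn : 0 < n)
    (h : ∀ j < n, ∀ k, walk x j k < n) (t : ℕ) : (state x t).awake ⊆ {j | j < n} := by
  induction t with
  | zero => simpa [state] using hn
  | succ t ih =>
    rintro i (hi | ⟨j, hj, hw⟩)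
    · exact ih hi
    · have := hw ▸ h j (ih hj) _
      exact_mod_cast this

theorem steps_eq_zero_of_notMem_awake {x : ℕ → ℕ → ℤ} {t j : ℕ}
    (h : j ∉ (state x t).awake) : (state x t).steps j = 0 := by
  induction t with
  | zero => rfl
  | succ t ih =>
    have h' : j ∉ (state x t).awake := fun hj => h (Or.inl hj)
    simpa [state, h'] using ih h'

theorem exists_steps_eq_zero {x : ℕ → ℕ → ℤ} {t j : ℕ} (h : j ∈ (state x t).awake) :
    ∃ s, j ∈ (state x s).awake ∧ (state x s).steps j = 0 := by
  induction t with
  | zero => exact ⟨0, h, rfl⟩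
  | succ t ih =>
    by_cases hj : j ∈ (state x t).awake
    · exact ih hj
    · exact ⟨t + 1, h, by simpa [state, hj] using steps_eq_zero_of_notMem_awake hj⟩

/-- An awake frog moves at every tick, so its step counter skips no value. This allows the timed
dynamics to be replaced by the free walks. -/
theorem exists_steps_eq {x : ℕ → ℕ → ℤ} {t j : ℕ} (h : j ∈ (state x t).awake) (k : ℕ) :
    ∃ s, j ∈ (state x s).awake ∧ (state x s).steps j = k := by
  induction k with
  | zero => exact exists_steps_eq_zero h
  | succ k ih =>
    obtain ⟨s, hs, hk⟩ := ih
    exact ⟨s + 1, Or.inl hs, by simp [state, hs, hk]⟩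

theorem exists_mem_awake_of_walk_eq {x : ℕ → ℕ → ℤ} {t i j k : ℕ}
    (h : j ∈ (state x t).awake) (hw : walk x j k = i) : ∃ s, i ∈ (state x s).awake := by
  cases k with
  | zero =>
    have : j = i := by simpa [walk] using hw
    exact ⟨t, this ▸ h⟩
  | succ k =>
    obtain ⟨s, hs, hk⟩ := exists_steps_eq h k
    exact ⟨s + 1, Or.inr ⟨j, hs, by simpa [hs, hk] using hw⟩⟩

/-- Discrete intermediate value property: a walk with unit steps jumps over no site. -/
theorem exists_sum_eq_of_le_sum {y : ℕ → ℤ} (hy : ∀ k, y k = -1 ∨ y k = 1) {m : ℤ} (hm : 0 ≤ m)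
    {k : ℕ} (hk : m ≤ ∑ i ∈ Finset.range k, y i) : ∃ l, ∑ i ∈ Finset.range l, y i = m := by
  induction k with
  | zero => exact ⟨0, le_antisymm (by simpa using hm) hk⟩
  | succ k ih =>
    by_cases h : m ≤ ∑ i ∈ Finset.range k, y i
    · exact ih h
    · refine ⟨k + 1, ?_⟩
      rw [Finset.sum_range_succ] at hk ⊢
      rcases hy k with h' | h' <;> rw [h'] at hk ⊢ <;> omega

/-- Frog `j` would get at least `m` sites to the right of its starting point. -/
def Climbs (x : ℕ → ℕ → ℤ) (j m : ℕ) : Prop := ∃ k, (m : ℤ) ≤ ∑ i ∈ Finset.range k, x j i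

theorem exists_climbs_of_infinite {x : ℕ → ℕ → ℤ} (h : {j | HitsOrigin x j}.Infinite) {n : ℕ}
    (hn : 0 < n) : ∃ j < n, Climbs x j (n - j) := by
  by_contra! hc
  refine h ((Set.finite_lt_nat n).subset ?_)
  rintro j ⟨t, ht, -⟩
  refine awake_subset_of_walk_lt hn (fun j hj k => ?_) t ht
  by_contra! hk
  refine hc j hj ⟨k, ?_⟩
  simp only [walk] at hk
  omega

theorem infinite_of_forall_climbs {x : ℕ → ℕ → ℤ} (hx : ∀ j k, x j k = -1 ∨ x j k = 1)
    (hleft : ∀ j : ℕ, ∃ k, (j : ℤ) ≤ ∑ i ∈ Finset.range k, -x j i)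
    (h : ∀ n, 0 < n → ∃ j < n, Climbs x j (n - j)) : {j | HitsOrigin x j}.Infinite := by
  have hawake : ∀ n, ∃ t, n ∈ (state x t).awake := by
    intro n
    induction n using Nat.strong_induction_on with
    | _ n ih =>
      rcases Nat.eq_zero_or_pos n with rfl | hn
      · exact ⟨0, rfl⟩
      · obtain ⟨j, hj, k, hk⟩ := h n hn
        obtain ⟨t, ht⟩ := ih j hj
        obtain ⟨l, hl⟩ := exists_sum_eq_of_le_sum (hx j) (Int.natCast_nonneg _) hk
        refine exists_mem_awake_of_walk_eq ht (k := l) ?_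
        simp only [walk]
        omega
  refine Set.infinite_of_forall_exists_gt fun n => ⟨n + 1, ?_, n.lt_succ_self⟩
  obtain ⟨k, hk⟩ := hleft (n + 1)
  obtain ⟨l, hl⟩ := exists_sum_eq_of_le_sum (y := fun i => -x (n + 1) i)
    (fun i => by rcases hx (n + 1) i with h | h <;> simp [h]) (Int.natCast_nonneg _) hk
  obtain ⟨t, ht⟩ := hawake (n + 1)
  obtain ⟨s, hs, hsl⟩ := exists_steps_eq ht l
  refine ⟨s, hs, ?_⟩
  rw [hsl, walk]
  rw [Finset.sum_neg_distrib] at hl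
  omega

/-! ### Series and integral estimates -/

theorem hasSum_one_div_succ_sq :
    HasSum (fun k : ℕ => 1 / ((k : ℝ) + 1) ^ 2) (Real.pi ^ 2 / 6) := by
  have h := (hasSum_nat_add_iff' 1).mpr hasSum_zeta_two
  simpa using h

theorem hasSum_neg_log_one_sub {y : ℝ} (h0 : 0 ≤ y) (h1 : y < 1) :
    HasSum (fun k : ℕ => y ^ (k + 1) / (k + 1)) (-Real.log (1 - y)) :=
  Real.hasSum_pow_div_log_of_abs_lt_one (by rwa [abs_of_nonneg h0])

/-- Expand the logarithm in powers of `exp (-x)` and integrate term by term; the terms are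
nonnegative with summable integrals. -/
theorem integral_abs_log_one_sub_exp_neg :
    ∫ x in Set.Ioi (0 : ℝ), |Real.log (1 - Real.exp (-x))| = Real.pi ^ 2 / 6 := by
  have hneg : ∀ k : ℕ, -((k : ℝ) + 1) < 0 := fun k => by linarith [k.cast_nonneg (α := ℝ)]
  let F : ℕ → ℝ → ℝ := fun k x => Real.exp (-((k : ℝ) + 1) * x) / (k + 1)
  have hF : ∀ k, IntegrableOn (F k) (Set.Ioi 0) := fun k =>
    (integrableOn_exp_mul_Ioi (hneg k) 0).div_const _
  have hFi : ∀ k, ∫ x in Set.Ioi 0, F k x = 1 / ((k : ℝ) + 1) ^ 2 := by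
    intro k
    have hk : (k : ℝ) + 1 ≠ 0 := by positivity
    simp only [F]
    rw [integral_div, integral_exp_mul_Ioi (hneg k), mul_zero, Real.exp_zero, neg_div_neg_eq]
    field_simp
  have hpos : ∀ k x, ‖F k x‖ = F k x := fun k x =>
    Real.norm_of_nonneg (by positivity)
  have h := hasSum_integral_of_summable_integral_norm (μ := volume.restrict (Set.Ioi 0)) hF (by
    simp only [hpos, hFi]
    exact hasSum_one_div_succ_sq.summable)
  simp only [hFi] at h
  rw [hasSum_one_div_succ_sq.unique h]
  refine setIntegral_congr_fun measurableSet_Ioi fun x hx => ?_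
  have hx0 : (0 : ℝ) < x := hx
  have h1 : Real.exp (-x) < 1 := by simpa using hx0
  have hs := hasSum_neg_log_one_sub (Real.exp_pos (-x)).le h1
  have : Real.log (1 - Real.exp (-x)) ≤ 0 :=
    Real.log_nonpos (by linarith) (by linarith [Real.exp_pos (-x)])
  simp only [abs_of_nonpos this, ← hs.tsum_eq, F]
  refine tsum_congr fun k => ?_
  rw [← Real.exp_nat_mul]
  congr 2
  push_cast
  ring

/-- The integral of a non-integrable function is `0` by convention, so a nonzero value forces
integrability. -/
theorem integrableOn_abs_log_one_sub_exp_neg :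
    IntegrableOn (fun x : ℝ => |Real.log (1 - Real.exp (-x))|) (Set.Ioi 0) :=
  Integrable.of_integral_ne_zero (by rw [integral_abs_log_one_sub_exp_neg]; positivity)

theorem sum_pow_succ_eq {y : ℝ} (hy : y ≠ 1) (M : ℕ) :
    ∑ m ∈ Finset.range M, y ^ (m + 1) = y * (1 - y ^ M) / (1 - y) := by
  have h1 : 1 - y ≠ 0 := sub_ne_zero.mpr hy.symm
  rw [eq_div_iff h1]
  simp only [pow_succ, ← Finset.sum_mul]
  have := geom_sum_mul_neg y M
  linear_combination y * this

/-- Expanding each logarithm and exchanging the sums leaves a geometric inner sum over `m`. -/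
theorem hasSum_sum_neg_log_one_sub_pow {r : ℝ} (h0 : 0 < r) (h1 : r < 1) (M : ℕ) :
    HasSum (fun k : ℕ => (∑ m ∈ Finset.range M, (r ^ (k + 1)) ^ (m + 1)) / (k + 1))
      (∑ m ∈ Finset.range M, -Real.log (1 - r ^ (m + 1))) := by
  have h := hasSum_sum (s := Finset.range M) fun m _ =>
    hasSum_neg_log_one_sub (y := r ^ (m + 1)) (by positivity)
      (pow_lt_one₀ h0.le h1 m.succ_ne_zero)
  convert h using 2 with k
  rw [Finset.sum_div]
  exact Finset.sum_congr rfl fun m _ => by rw [← pow_mul, ← pow_mul, mul_comm]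

theorem sum_neg_log_one_sub_pow_le {a : ℝ} (ha : 0 < a) (M : ℕ) :
    ∑ m ∈ Finset.range M, -Real.log (1 - Real.exp (-a) ^ (m + 1)) ≤ Real.pi ^ 2 / (6 * a) := by
  have h1 : Real.exp (-a) < 1 := by simpa using ha
  have h2 := hasSum_one_div_succ_sq.mul_right (1 / a)
  have h3 : Real.pi ^ 2 / (6 * a) = Real.pi ^ 2 / 6 * (1 / a) := by field_simp
  rw [h3]
  refine hasSum_le (fun k => ?_) (hasSum_sum_neg_log_one_sub_pow (Real.exp_pos _) h1 M) h2
  set b : ℝ := a * (k + 1) with hb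
  have hb0 : 0 < b := by positivity
  have hy : Real.exp (-a) ^ (k + 1) = Real.exp (-b) := by
    rw [← Real.exp_nat_mul]; congr 1; push_cast; ring
  have hy1 : Real.exp (-b) < 1 := by simpa using hb0
  rw [hy, sum_pow_succ_eq hy1.ne]
  -- This is `b + 1 ≤ exp b` in disguise. It is uniform in `M` and loses no constant, as the
  -- critical case requires.
  have key : Real.exp (-b) * (1 - Real.exp (-b) ^ M) / (1 - Real.exp (-b)) ≤ 1 / b := by
    rw [div_le_div_iff₀ (by linarith) hb0]
    have e1 : Real.exp (-b) * (b + 1) ≤ 1 := by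
      calc Real.exp (-b) * (b + 1) ≤ Real.exp (-b) * Real.exp b := by
            gcongr; exact Real.add_one_le_exp b
        _ = 1 := by rw [← Real.exp_add]; simp
    have e2 : 0 ≤ Real.exp (-b) ^ M := by positivity
    have e3 : 0 ≤ Real.exp (-b) * Real.exp (-b) ^ M * b := by positivity
    nlinarith
  calc _ ≤ 1 / b / ((k : ℝ) + 1) := by gcongr
    _ = _ := by rw [hb]; field_simp

theorem le_sum_neg_log_one_sub_pow {r : ℝ} (h0 : 0 < r) (h1 : r < 1) (K M : ℕ) :
    r ^ K * (1 - r ^ M) / (1 - r) * ∑ k ∈ Finset.range K, 1 / ((k : ℝ) + 1) ^ 2 ≤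
      ∑ m ∈ Finset.range M, -Real.log (1 - r ^ (m + 1)) := by
  have hr : 0 < 1 - r := by linarith
  refine le_trans ?_ (sum_le_hasSum (Finset.range K) (fun k _ => by positivity)
    (hasSum_sum_neg_log_one_sub_pow h0 h1 M))
  rw [Finset.mul_sum]
  refine Finset.sum_le_sum fun k hk => ?_
  have hk' : k + 1 ≤ K := Finset.mem_range.mp hk
  have hy1 : r ^ (k + 1) < 1 := pow_lt_one₀ h0.le h1 k.succ_ne_zero
  rw [sum_pow_succ_eq hy1.ne]
  -- Bernoulli's inequality; it supplies the second factor `k + 1` of the square.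
  have hden : 1 - r ^ (k + 1) ≤ (k + 1) * (1 - r) := by
    have := one_add_mul_le_pow (a := r - 1) (by linarith) (k + 1)
    push_cast at this
    rw [add_sub_cancel] at this
    linarith
  have hM : (r ^ (k + 1)) ^ M ≤ r ^ M := by
    rw [← pow_mul]
    exact pow_le_pow_of_le_one h0.le h1.le (Nat.le_mul_of_pos_left M k.succ_pos)
  have hM1 : r ^ M ≤ 1 := pow_le_one₀ h0.le h1.le
  calc r ^ K * (1 - r ^ M) / (1 - r) * (1 / ((k : ℝ) + 1) ^ 2)
      = r ^ K * (1 - r ^ M) / ((k + 1) * (1 - r)) / (k + 1) := by field_simp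
    _ ≤ r ^ (k + 1) * (1 - (r ^ (k + 1)) ^ M) / (1 - r ^ (k + 1)) / (k + 1) := by
      have hA : 0 ≤ 1 - r ^ M := by linarith
      have hB : r ^ K ≤ r ^ (k + 1) := pow_le_pow_of_le_one h0.le h1.le hk'
      have hC : 0 < 1 - r ^ (k + 1) := by linarith
      have hD : 1 - r ^ M ≤ 1 - (r ^ (k + 1)) ^ M := by linarith
      have hE : 0 ≤ r ^ (k + 1) * (1 - (r ^ (k + 1)) ^ M) :=
        mul_nonneg (by positivity) (hA.trans hD)
      gcongr

/-! ### Hitting probabilities of a nearest-neighbour random walk -/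

/-- The probability that a nearest-neighbour walk from `0`, which steps up with probability `r`,
reaches `m` within `k` steps. -/
def hitProb (r : ℝ) : ℕ → ℕ → ℝ
  | _, 0 => 1
  | 0, _ + 1 => 0
  | k + 1, m + 1 => r * hitProb r k m + (1 - r) * hitProb r k (m + 2)

@[simp] theorem hitProb_zero_right (r : ℝ) (k : ℕ) : hitProb r k 0 = 1 := by
  cases k <;> rfl

/-- The powers of `r / (1 - r)` solve the stationary recursion and dominate the values at `k = 0`.
-/
theorem hitProb_le_pow {r : ℝ} (h0 : 0 ≤ r) (h1 : r < 1) (k m : ℕ) :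
    hitProb r k m ≤ (r / (1 - r)) ^ m := by
  have hr : 0 < 1 - r := by linarith
  have hσ : 0 ≤ r / (1 - r) := by positivity
  induction k generalizing m with
  | zero => cases m <;> simp [hitProb]; positivity
  | succ k ih =>
    cases m with
    | zero => simp
    | succ m =>
      calc hitProb r (k + 1) (m + 1)
          = r * hitProb r k m + (1 - r) * hitProb r k (m + 2) := rfl
        _ ≤ r * (r / (1 - r)) ^ m + (1 - r) * (r / (1 - r)) ^ (m + 2) := by
            gcongr <;> exact ih _
        _ = (r / (1 - r)) ^ (m + 1) := by
            rw [pow_succ _ (m + 1), pow_succ]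
            field_simp
            ring

/-- Solutions of the recursion for hitting probabilities. -/
theorem eq_one_sub_mul_geom_sum {r : ℝ} (h1 : r < 1) {a : ℕ → ℝ} (ha0 : a 0 = 1)
    (ha : ∀ m, a (m + 1) = r * a m + (1 - r) * a (m + 2)) (m : ℕ) :
    a m = 1 - (1 - a 1) * ∑ i ∈ Finset.range m, (r / (1 - r)) ^ i := by
  have hr : 1 - r ≠ 0 := by linarith
  -- The recursion makes successive differences geometric.
  have hd : ∀ m, a m - a (m + 1) = (1 - a 1) * (r / (1 - r)) ^ m := by
    intro m
    induction m with
    | zero => simp [ha0]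
    | succ m ih =>
      rw [pow_succ, ← mul_assoc, ← ih, mul_div_assoc', eq_div_iff hr]
      linear_combination ha m
  induction m with
  | zero => simp [ha0]
  | succ m ih =>
    rw [Finset.sum_range_succ]
    linear_combination ih - hd m

/-- The solutions form a one-parameter family; nonnegativity as `m → ∞` bounds `a 1` below by the
value that `hle` allows at most. -/
theorem eq_pow_of_recursion {r : ℝ} (h0 : 0 ≤ r) (h1 : r < 1 / 2) {a : ℕ → ℝ} (ha0 : a 0 = 1)
    (ha : ∀ m, a (m + 1) = r * a m + (1 - r) * a (m + 2)) (hnn : ∀ m, 0 ≤ a m)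
    (hle : a 1 ≤ r / (1 - r)) (m : ℕ) : a m = (r / (1 - r)) ^ m := by
  have hr : 0 < 1 - r := by linarith
  have hσ0 : 0 ≤ r / (1 - r) := by positivity
  have hσ1 : r / (1 - r) < 1 := by rw [div_lt_one hr]; linarith
  have hsol := eq_one_sub_mul_geom_sum (by linarith) ha0 ha
  set σ := r / (1 - r)
  have hg : ∀ m, ∑ i ∈ Finset.range m, σ ^ i = (1 - σ ^ m) / (1 - σ) := fun m => by
    rw [eq_div_iff (by linarith)]; exact geom_sum_mul_neg σ m
  have hlim : Tendsto (fun m => (1 - a 1) * (1 - σ ^ m)) atTop (𝓝 ((1 - a 1) * (1 - 0))) :=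
    ((tendsto_pow_atTop_nhds_zero_of_lt_one hσ0 hσ1).const_sub 1).const_mul _
  have hd : (1 - a 1) * (1 - 0) ≤ 1 - σ := by
    refine le_of_tendsto' hlim fun m => ?_
    have h := hnn m
    rw [hsol m, hg, ← mul_div_assoc, sub_nonneg, div_le_one (by linarith)] at h
    exact h
  have hd' : 1 - a 1 = 1 - σ := by linarith
  rw [hsol m, hg, hd']
  have : 1 - σ ≠ 0 := by linarith
  field_simp
  ring

/-- Here the geometric sums are unbounded, so nonnegativity leaves only the constant solution. -/
theorem eq_one_of_recursion {r : ℝ} (h0 : 1 / 2 ≤ r) (h1 : r < 1) {a : ℕ → ℝ} (ha0 : a 0 = 1)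
    (ha : ∀ m, a (m + 1) = r * a m + (1 - r) * a (m + 2)) (hnn : ∀ m, 0 ≤ a m)
    (hle : a 1 ≤ 1) (m : ℕ) : a m = 1 := by
  have hr : 0 < 1 - r := by linarith
  have hσ1 : 1 ≤ r / (1 - r) := by rw [le_div_iff₀ hr]; linarith
  have hsol := eq_one_sub_mul_geom_sum h1 ha0 ha
  have hd : 1 - a 1 = 0 := by
    by_contra hne
    have hpos : 0 < 1 - a 1 := lt_of_le_of_ne (by linarith) (Ne.symm hne)
    obtain ⟨n, hn⟩ := exists_nat_gt (1 / (1 - a 1))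
    rw [div_lt_iff₀ hpos] at hn
    have h := hnn n
    rw [hsol n] at h
    have hs : (n : ℝ) ≤ ∑ i ∈ Finset.range n, (r / (1 - r)) ^ i := by
      calc (n : ℝ) = ∑ i ∈ Finset.range n, (1 : ℝ) := by simp
        _ ≤ _ := Finset.sum_le_sum fun i _ => one_le_pow₀ hσ1
    nlinarith
  rw [hsol m, hd]
  simp

section Walk

variable {Ω : Type*}

/-- The event that the walk with steps `η s, η (s + 1), …` reaches `m` within `k` steps. -/
def hitWithin (η : ℕ → Ω → ℤ) (s k m : ℕ) : Set Ω :=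
  {ω | ∃ i ≤ k, (m : ℤ) ≤ ∑ l ∈ Finset.range i, η (s + l) ω}

/-- The event that the walk with steps `η 0, η 1, …` ever reaches `m`. -/
def hitEver (η : ℕ → Ω → ℤ) (m : ℕ) : Set Ω :=
  {ω | ∃ i, (m : ℤ) ≤ ∑ l ∈ Finset.range i, η l ω}

theorem hitWithin_zero_right (η : ℕ → Ω → ℤ) (s k : ℕ) : hitWithin η s k 0 = Set.univ :=
  Set.eq_univ_of_forall fun _ => ⟨0, k.zero_le, by simp⟩

theorem hitWithin_zero_succ (η : ℕ → Ω → ℤ) (s m : ℕ) : hitWithin η s 0 (m + 1) = ∅ := by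
  refine Set.eq_empty_of_forall_notMem ?_
  rintro ω ⟨i, hi, h⟩
  obtain rfl : i = 0 := by omega
  simp at h
  omega

theorem mem_hitWithin_succ {η : ℕ → Ω → ℤ} {s k m : ℕ} {ω : Ω} :
    ω ∈ hitWithin η s (k + 1) (m + 1) ↔
      ∃ i ≤ k, ((m + 1 : ℕ) : ℤ) ≤ η s ω + ∑ l ∈ Finset.range i, η (s + 1 + l) ω := by
  have hsum : ∀ i, ∑ l ∈ Finset.range (i + 1), η (s + l) ω =
      η s ω + ∑ l ∈ Finset.range i, η (s + 1 + l) ω := fun i => by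
    rw [Finset.sum_range_succ', add_comm, add_zero]
    simp only [add_assoc, add_comm 1]
  constructor
  · rintro ⟨i, hi, h⟩
    cases i with
    | zero => simp at h; omega
    | succ i =>
      exact ⟨i, by omega, hsum i ▸ h⟩
  · rintro ⟨i, hi, h⟩
    exact ⟨i + 1, by omega, (hsum i).symm ▸ h⟩

theorem measurableSet_hitWithin {m' : MeasurableSpace Ω} {η : ℕ → Ω → ℤ} {s : ℕ}
    (h : ∀ l, Measurable[m'] (η (s + l))) (k m : ℕ) : MeasurableSet[m'] (hitWithin η s k m) := by
  have : hitWithin η s k m =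
      ⋃ i ∈ Set.Iic k, {ω | (m : ℤ) ≤ ∑ l ∈ Finset.range i, η (s + l) ω} := by
    ext ω; simp [hitWithin]
  rw [this]
  refine MeasurableSet.biUnion (Set.to_countable _) fun i _ => ?_
  exact measurableSet_le measurable_const (Finset.measurable_fun_sum _ fun l _ => h l)

theorem hitEver_eq_iUnion (η : ℕ → Ω → ℤ) (m : ℕ) : hitEver η m = ⋃ k, hitWithin η 0 k m := by
  ext ω
  simp only [hitEver, hitWithin, Set.mem_ofPred_eq, Set.mem_iUnion, zero_add]
  exact ⟨fun ⟨i, h⟩ => ⟨i, i, le_rfl, h⟩, fun ⟨_, i, _, h⟩ => ⟨i, h⟩⟩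

theorem measurableSet_hitEver {m' : MeasurableSpace Ω} {η : ℕ → Ω → ℤ}
    (h : ∀ l, Measurable[m'] (η l)) (m : ℕ) : MeasurableSet[m'] (hitEver η m) := by
  rw [hitEver_eq_iUnion]
  exact .iUnion fun k => measurableSet_hitWithin (fun l => by simpa using h l) k m

variable [MeasurableSpace Ω]

/-- Independent `±1` steps, each equal to `1` with probability `r`. -/
structure IsNearestNeighbour (μ : Measure Ω) (r : ℝ) (η : ℕ → Ω → ℤ) : Prop where
  measurable : ∀ k, Measurable (η k)
  down : ∀ k, μ.real {ω | η k ω = -1} = 1 - r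
  up : ∀ k, μ.real {ω | η k ω = 1} = r
  indep : iIndepFun η μ

variable {μ : Measure Ω} {r : ℝ} {η : ℕ → Ω → ℤ}

theorem IsNearestNeighbour.indep_hitWithin (h : IsNearestNeighbour μ r η) (s k m : ℕ) (c : ℤ) :
    μ.real ({ω | η s ω = c} ∩ hitWithin η (s + 1) k m) =
      μ.real {ω | η s ω = c} * μ.real (hitWithin η (s + 1) k m) := by
  have hi := indep_iSup_of_disjoint (fun i => (h.measurable i).comap_le) h.indep.iIndep
    (S := {s}) (T := Set.Ioi s) (by simp)
  have := (Indep_iff _ _ _).mp hi {ω | η s ω = c} (hitWithin η (s + 1) k m) ?_ ?_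
  · simp only [measureReal_def, this, ENNReal.toReal_mul]
  · have : MeasurableSet[MeasurableSpace.comap (η s) inferInstance] {ω | η s ω = c} :=
      ⟨{c}, measurableSet_singleton _, rfl⟩
    exact le_iSup₂ (f := fun i (_ : i ∈ ({s} : Set ℕ)) =>
      MeasurableSpace.comap (η i) inferInstance) s rfl _ this
  · refine measurableSet_hitWithin (fun l => ?_) k m
    exact Measurable.mono (comap_measurable _) (le_iSup₂ (f := fun i (_ : i ∈ Set.Ioi s) =>
      MeasurableSpace.comap (η i) inferInstance) (s + 1 + l) (by simp; omega)) le_rfl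

variable [IsProbabilityMeasure μ]

theorem IsNearestNeighbour.ae_eq (h : IsNearestNeighbour μ r η) (k : ℕ) :
    ∀ᵐ ω ∂μ, η k ω = -1 ∨ η k ω = 1 := by
  have hd : Disjoint {ω | η k ω = -1} {ω | η k ω = 1} :=
    Set.disjoint_left.mpr fun ω h1 h2 => by
      simp only [Set.mem_ofPred_eq] at h1 h2; omega
  have hm1 : MeasurableSet {ω | η k ω = -1} := h.measurable k (measurableSet_singleton _)
  have hm2 : MeasurableSet {ω | η k ω = 1} := h.measurable k (measurableSet_singleton _)
  have := measureReal_union (μ := μ) hd hm2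
  rw [h.down, h.up, sub_add_cancel] at this
  have hc := prob_compl_eq_one_sub (μ := μ) (hm1.union hm2)
  rw [measureReal_def, ENNReal.toReal_eq_one_iff] at this
  rw [this, tsub_self] at hc
  exact hc

theorem IsNearestNeighbour.measureReal_hitWithin (h : IsNearestNeighbour μ r η) (s k m : ℕ) :
    μ.real (hitWithin η s k m) = hitProb r k m := by
  induction k generalizing s m with
  | zero =>
    cases m with
    | zero => simp [hitWithin_zero_right]
    | succ m => simp [hitWithin_zero_succ, hitProb]
  | succ k ih =>
    cases m with
    | zero => simp [hitWithin_zero_right]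
    | succ m =>
      -- Split on the first step; the remaining walk starts at time `s + 1`, which is why `s` varies
      -- in the induction.
      have hae : hitWithin η s (k + 1) (m + 1) =ᵐ[μ]
          (({ω | η s ω = 1} ∩ hitWithin η (s + 1) k m) ∪
            ({ω | η s ω = -1} ∩ hitWithin η (s + 1) k (m + 2)) : Set Ω) := by
        rw [eventuallyEq_set]
        filter_upwards [h.ae_eq s] with ω hω
        rw [mem_hitWithin_succ]
        simp only [hitWithin, Set.mem_union, Set.mem_inter_iff, Set.mem_ofPred_eq]
        rcases hω with hω | hω <;> rw [hω] <;> simp only [false_and, true_and,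
          false_or, or_false, show ¬ ((-1 : ℤ) = 1) by decide, show ¬ ((1 : ℤ) = -1) by decide] <;>
        refine exists_congr fun i => and_congr_right fun _ => ?_ <;> push_cast <;> constructor <;>
          intro <;> linarith
      have hd : Disjoint ({ω | η s ω = 1} ∩ hitWithin η (s + 1) k m)
          ({ω | η s ω = -1} ∩ hitWithin η (s + 1) k (m + 2)) :=
        Set.disjoint_left.mpr fun ω h1 h2 => by
          have h1 := h1.1; have h2 := h2.1
          simp only [Set.mem_ofPred_eq] at h1 h2; omega
      have hm : MeasurableSet ({ω | η s ω = -1} ∩ hitWithin η (s + 1) k (m + 2)) :=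
        (h.measurable s (measurableSet_singleton _)).inter
          (measurableSet_hitWithin (fun l => h.measurable _) k _)
      rw [measureReal_congr hae, measureReal_union hd hm, h.indep_hitWithin, h.indep_hitWithin,
        h.up, h.down, ih, ih]
      rfl

theorem IsNearestNeighbour.tendsto_hitProb (h : IsNearestNeighbour μ r η) (m : ℕ) :
    Tendsto (fun k => hitProb r k m) atTop (𝓝 (μ.real (hitEver η m))) := by
  have hmono : Monotone fun k => hitWithin η 0 k m :=
    fun k k' hk ω ⟨i, hi, h⟩ => ⟨i, hi.trans hk, h⟩
  have := tendsto_measure_iUnion_atTop (μ := μ) hmono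
  rw [← hitEver_eq_iUnion] at this
  have := (ENNReal.tendsto_toReal (measure_ne_top μ _)).comp this
  refine this.congr fun k => ?_
  exact h.measureReal_hitWithin 0 k m

theorem IsNearestNeighbour.hitEver_zero :
    μ.real (hitEver η 0) = 1 := by
  have : hitEver η 0 = Set.univ := Set.eq_univ_of_forall fun _ => ⟨0, by simp⟩
  simp [this]

theorem IsNearestNeighbour.hitEver_succ (h : IsNearestNeighbour μ r η) (m : ℕ) :
    μ.real (hitEver η (m + 1)) =
      r * μ.real (hitEver η m) + (1 - r) * μ.real (hitEver η (m + 2)) :=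
  tendsto_nhds_unique ((h.tendsto_hitProb (m + 1)).comp (tendsto_add_atTop_nat 1))
    (((h.tendsto_hitProb m).const_mul r).add ((h.tendsto_hitProb (m + 2)).const_mul (1 - r)))

theorem IsNearestNeighbour.measureReal_hitEver (h : IsNearestNeighbour μ r η) (h0 : 0 ≤ r)
    (h1 : r < 1 / 2) (m : ℕ) : μ.real (hitEver η m) = (r / (1 - r)) ^ m :=
  eq_pow_of_recursion h0 h1 hitEver_zero h.hitEver_succ (fun _ => measureReal_nonneg)
    (le_of_tendsto' (h.tendsto_hitProb 1) fun k => by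
      simpa using hitProb_le_pow h0 (by linarith) k 1) m

theorem IsNearestNeighbour.ae_mem_hitEver (h : IsNearestNeighbour μ r η) (h0 : 1 / 2 ≤ r)
    (h1 : r < 1) (m : ℕ) : ∀ᵐ ω ∂μ, ω ∈ hitEver η m := by
  have := eq_one_of_recursion h0 h1 hitEver_zero h.hitEver_succ (fun _ => measureReal_nonneg)
    measureReal_le_one m
  rw [measureReal_def, ENNReal.toReal_eq_one_iff] at this
  rw [← mem_ae_iff_prob_eq_one₀
    (measurableSet_hitEver h.measurable m).nullMeasurableSet] at this
  exact this

end Walk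

/-! ### A renewal form of the second Borel–Cantelli lemma -/

section Renewal

variable {Ω : Type*} [m0 : MeasurableSpace Ω] {μ : Measure Ω} [IsProbabilityMeasure μ]

/-- If the events `G n` renew, in the sense that given the past before `m` the event `G n` is at most
as likely as `G (n - m)` was from the start, and their probabilities are not summable, then almost
surely infinitely many of them occur. -/
theorem measure_iInter_compl_eq_zero_of_renewal {𝓕 : ℕ → MeasurableSpace Ω} (h𝓕 : Monotone 𝓕)
    (h𝓕le : ∀ n, 𝓕 n ≤ m0) {G : ℕ → Set Ω} (hG : ∀ n, MeasurableSet[𝓕 n] (G n)) {v : ℕ → ℝ}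
    (hv : ∀ n, μ.real (G n) = v n)
    (hren : ∀ m n, m ≤ n → ∀ A, MeasurableSet[𝓕 m] A → μ.real (A ∩ G n) ≤ μ.real A * v (n - m))
    (hns : ¬ Summable v) (K : ℕ) : μ (⋂ n ∈ Set.Ici K, (G n)ᶜ) = 0 := by
  have hv0 : ∀ n, 0 ≤ v n := fun n => hv n ▸ measureReal_nonneg
  have hv1 : ∀ n, v n ≤ 1 := fun n => hv n ▸ measureReal_le_one
  have hGm : ∀ n, MeasurableSet (G n) := fun n => h𝓕le n _ (hG n)
  -- The first occurrence from `K` on is at `m`; this event belongs to `𝓕 m`, so the renewal bound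
  -- applies to it.
  let B : ℕ → Set Ω := fun m => {ω | K ≤ m ∧ ω ∈ G m ∧ ∀ i, K ≤ i → i < m → ω ∉ G i}
  have hB𝓕 : ∀ m, MeasurableSet[𝓕 m] (B m) := by
    intro m
    have : B m = {ω | K ≤ m} ∩ (G m ∩ ⋂ i ∈ {i | K ≤ i ∧ i < m}, (G i)ᶜ) := by
      ext ω; simp [B, and_imp]
    rw [this]
    refine (MeasurableSet.const _).inter ((hG m).inter ?_)
    exact MeasurableSet.biInter (Set.to_countable _) fun i hi => (h𝓕 hi.2.le _ (hG i)).compl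
  have hBm : ∀ m, MeasurableSet (B m) := fun m => h𝓕le m _ (hB𝓕 m)
  have hBd : Pairwise (Function.onFun Disjoint B) := by
    intro m n hmn
    refine Set.disjoint_left.mpr fun ω h1 h2 => ?_
    rcases lt_or_gt_of_ne hmn with h | h
    · exact h2.2.2 m h1.1 h h1.2.1
    · exact h1.2.2 n h2.1 h h2.2.1
  set E : Set Ω := ⋃ n ∈ Set.Ici K, G n with hE
  have hEm : MeasurableSet E := MeasurableSet.biUnion (Set.to_countable _) fun n _ => hGm n
  have hBsum : ∀ N, ∑ m ∈ Finset.range N, μ.real (B m) ≤ μ.real E := by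
    intro N
    rw [← measureReal_biUnion_finset (fun m _ n _ h => hBd h) fun m _ => hBm m]
    refine measureReal_mono (Set.iUnion₂_subset fun m _ ω hω => ?_) (measure_ne_top _ _)
    exact Set.mem_biUnion hω.1 hω.2.1
  have hdecomp : ∀ N n, n < N → v n ≤ (if n < K then 1 else 0) +
      ∑ m ∈ Finset.range N, μ.real (B m) * if m ≤ n then v (n - m) else 0 := by
    intro N n hn
    have hnn : ∀ m ∈ Finset.range N, 0 ≤ μ.real (B m) * if m ≤ n then v (n - m) else 0 :=
      fun m _ => mul_nonneg measureReal_nonneg (by split_ifs; exacts [hv0 _, le_rfl])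
    by_cases hK : n < K
    · rw [if_pos hK]
      linarith [hv1 n, Finset.sum_nonneg hnn]
    · have hsub : G n ⊆ ⋃ m ∈ Finset.range (n + 1), B m ∩ G n := by
        classical
        intro ω hω
        have hex : ∃ m, K ≤ m ∧ ω ∈ G m := ⟨n, not_lt.mp hK, hω⟩
        have hmin := Nat.find_min' hex ⟨not_lt.mp hK, hω⟩
        refine Set.mem_biUnion (x := Nat.find hex) (by simpa using! Nat.lt_succ_of_le hmin)
          ⟨⟨(Nat.find_spec hex).1, (Nat.find_spec hex).2, fun i hi hlt hGi => ?_⟩, hω⟩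
        exact Nat.find_min hex hlt ⟨hi, hGi⟩
      rw [if_neg hK, zero_add]
      calc v n = μ.real (G n) := (hv n).symm
        _ ≤ μ.real (⋃ m ∈ Finset.range (n + 1), B m ∩ G n) :=
            measureReal_mono hsub (measure_ne_top _ _)
        _ ≤ ∑ m ∈ Finset.range (n + 1), μ.real (B m ∩ G n) := measureReal_biUnion_finset_le _ _
        _ ≤ ∑ m ∈ Finset.range (n + 1), μ.real (B m) * if m ≤ n then v (n - m) else 0 := by
            refine Finset.sum_le_sum fun m hm => ?_
            have hmn : m ≤ n := Nat.lt_succ_iff.mp (Finset.mem_range.mp hm)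
            rw [if_pos hmn]
            exact hren m n hmn _ (hB𝓕 m)
        _ ≤ _ := Finset.sum_le_sum_of_subset_of_nonneg
            (Finset.range_subset_range.mpr hn) fun m hm _ => hnn m hm
  have hshift : ∀ N m, ∑ n ∈ Finset.range N, (if m ≤ n then v (n - m) else 0) ≤
      ∑ n ∈ Finset.range N, v n := by
    intro N m
    rw [← Finset.sum_filter]
    have : (Finset.range N).filter (m ≤ ·) = Finset.Ico m N := by
      ext; simp [and_comm]
    rw [this, Finset.sum_Ico_eq_sum_range]
    simp only [add_tsub_cancel_left]
    exact Finset.sum_le_sum_of_subset_of_nonneg (Finset.range_subset_range.mpr (Nat.sub_le _ _))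
      fun n _ _ => hv0 n
  -- Summing the first-occurrence decomposition gives `V ≤ K + μ.real E * V` for each partial sum
  -- `V`. As `V` is unbounded, `E` has full measure.
  have hbound : ∀ N, (∑ n ∈ Finset.range N, v n) * (1 - μ.real E) ≤ K := by
    intro N
    have hcount : ∑ n ∈ Finset.range N, (if n < K then (1 : ℝ) else 0) ≤ K := by
      rw [← Finset.sum_filter, Finset.sum_const, nsmul_eq_mul, mul_one, Nat.cast_le]
      calc _ ≤ (Finset.range K).card := Finset.card_le_card fun n hn => by
            simpa using (Finset.mem_filter.mp hn).2
        _ = K := Finset.card_range K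
    have hV : 0 ≤ ∑ n ∈ Finset.range N, v n := Finset.sum_nonneg fun n _ => hv0 n
    have h1 : ∑ n ∈ Finset.range N, v n ≤ K + μ.real E * ∑ n ∈ Finset.range N, v n := by
      calc ∑ n ∈ Finset.range N, v n
          ≤ ∑ n ∈ Finset.range N, ((if n < K then (1 : ℝ) else 0) +
              ∑ m ∈ Finset.range N, μ.real (B m) * if m ≤ n then v (n - m) else 0) :=
            Finset.sum_le_sum fun n hn => hdecomp N n (Finset.mem_range.mp hn)
        _ = ∑ n ∈ Finset.range N, (if n < K then (1 : ℝ) else 0) +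
              ∑ m ∈ Finset.range N, μ.real (B m) *
                ∑ n ∈ Finset.range N, if m ≤ n then v (n - m) else 0 := by
            rw [Finset.sum_add_distrib, Finset.sum_comm]
            simp only [Finset.mul_sum]
        _ ≤ K + ∑ m ∈ Finset.range N, μ.real (B m) * ∑ n ∈ Finset.range N, v n := by
            exact add_le_add hcount (Finset.sum_le_sum fun m _ =>
              mul_le_mul_of_nonneg_left (hshift N m) measureReal_nonneg)
        _ ≤ K + μ.real E * ∑ n ∈ Finset.range N, v n := by
            rw [← Finset.sum_mul]
            gcongr
            exact hBsum N
    linarith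
  have hE1 : 1 ≤ μ.real E := by
    by_contra! hlt
    have htop := (not_summable_iff_tendsto_nat_atTop_of_nonneg hv0).mp hns
    obtain ⟨N, hN⟩ := (htop.eventually_gt_atTop (K / (1 - μ.real E))).exists
    rw [div_lt_iff₀ (by linarith)] at hN
    linarith [hbound N]
  have hcompl : ⋂ n ∈ Set.Ici K, (G n)ᶜ = Eᶜ := by simp [hE]
  have h2 := probReal_compl_eq_one_sub (μ := μ) hEm
  rw [hcompl, ← measureReal_eq_zero_iff]
  exact le_antisymm (by linarith) measureReal_nonneg

end Renewal

/-! ### Independence of the frogs -/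

variable {Ω : Type*}

/-- The σ-algebra generated by the steps of the frogs in `S`. -/
abbrev frogSigma (ξ : ℕ → ℕ → Ω → ℤ) (S : Set ℕ) : MeasurableSpace Ω :=
  ⨆ i ∈ {i : ℕ × ℕ | i.1 ∈ S}, MeasurableSpace.comap (ξ i.1 i.2) inferInstance

/-- No frog `j ∈ s` would reach site `n`. -/
def noneReaches (ξ : ℕ → ℕ → Ω → ℤ) (s : Finset ℕ) (n : ℕ) : Set Ω :=
  ⋂ j ∈ s, (hitEver (ξ j) (n - j))ᶜ

/-- Every site `n ≥ 1` would be reached by some frog `j < n`. -/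
def allReached (ξ : ℕ → ℕ → Ω → ℤ) : Set Ω :=
  {ω | ∀ n, 0 < n → ∃ j < n, ω ∈ hitEver (ξ j) (n - j)}

/-- The odds of a right step against a left step of frog `j`. -/
noncomputable def odds (p : ℕ → ℝ) (j : ℕ) : ℝ := (1 - p j) / p j

theorem frogSigma_mono (ξ : ℕ → ℕ → Ω → ℤ) {S T : Set ℕ} (h : S ⊆ T) :
    frogSigma ξ S ≤ frogSigma ξ T :=
  biSup_mono fun _ hi => h hi

theorem measurable_frogSigma (ξ : ℕ → ℕ → Ω → ℤ) {S : Set ℕ} {j : ℕ} (hj : j ∈ S) (k : ℕ) :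
    Measurable[frogSigma ξ S] (ξ j k) :=
  Measurable.mono (comap_measurable _) (le_iSup₂ (f := fun (i : ℕ × ℕ)
    (_ : i ∈ {i : ℕ × ℕ | i.1 ∈ S}) => MeasurableSpace.comap (ξ i.1 i.2) inferInstance)
    (j, k) hj) le_rfl

theorem measurableSet_frogSigma_hitEver (ξ : ℕ → ℕ → Ω → ℤ) {S : Set ℕ} {j : ℕ} (hj : j ∈ S)
    (m : ℕ) : MeasurableSet[frogSigma ξ S] (hitEver (ξ j) m) :=
  measurableSet_hitEver (fun k => measurable_frogSigma ξ hj k) m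

theorem measurableSet_frogSigma_noneReaches (ξ : ℕ → ℕ → Ω → ℤ) {S : Set ℕ} {s : Finset ℕ}
    (h : ↑s ⊆ S) (n : ℕ) : MeasurableSet[frogSigma ξ S] (noneReaches ξ s n) :=
  s.measurableSet_biInter fun _ hj => (measurableSet_frogSigma_hitEver ξ (h hj) _).compl

theorem hitEver_anti (η : ℕ → Ω → ℤ) {m n : ℕ} (h : m ≤ n) : hitEver η n ⊆ hitEver η m :=
  fun _ ⟨i, hi⟩ => ⟨i, le_trans (by exact_mod_cast h) hi⟩

theorem odds_pos {p : ℕ → ℝ} {j : ℕ} (hp : 1 / 2 < p j ∧ p j < 1) : 0 < odds p j :=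
  div_pos (by linarith [hp.2]) (by linarith [hp.1])

theorem odds_lt_one {p : ℕ → ℝ} {j : ℕ} (hp : 1 / 2 < p j ∧ p j < 1) : odds p j < 1 :=
  (div_lt_one (by linarith [hp.1])).mpr (by linarith [hp.1])

variable [m0 : MeasurableSpace Ω] {μ : Measure Ω} {p : ℕ → ℝ}
  {ξ : ℕ → ℕ → Ω → ℤ}

namespace IsStepFamily

theorem frogSigma_le (hξ : IsStepFamily μ p ξ) (S : Set ℕ) : frogSigma ξ S ≤ m0 :=
  iSup₂_le fun i _ => (hξ.measurable i.1 i.2).comap_le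

theorem measureReal_inter (hξ : IsStepFamily μ p ξ) {S T : Set ℕ} (hST : Disjoint S T)
    {A B : Set Ω} (hA : MeasurableSet[frogSigma ξ S] A) (hB : MeasurableSet[frogSigma ξ T] B) :
    μ.real (A ∩ B) = μ.real A * μ.real B := by
  have hi := indep_iSup_of_disjoint (fun i : ℕ × ℕ => (hξ.measurable i.1 i.2).comap_le)
    hξ.indep.iIndep (S := {i | i.1 ∈ S}) (T := {i | i.1 ∈ T})
    (Set.disjoint_left.mpr fun i h1 h2 => Set.disjoint_left.mp hST h1 h2)
  simp only [measureReal_def, (Indep_iff _ _ _).mp hi A B hA hB, ENNReal.toReal_mul]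

theorem isNearestNeighbour (hξ : IsStepFamily μ p ξ) {j : ℕ} (hp : 1 / 2 < p j ∧ p j < 1) :
    IsNearestNeighbour μ (1 - p j) (ξ j) where
  measurable := hξ.measurable j
  down k := by
    rw [measureReal_def, hξ.left, ENNReal.toReal_ofReal (by linarith [hp.1]), sub_sub_cancel]
  up k := by rw [measureReal_def, hξ.right, ENNReal.toReal_ofReal (by linarith [hp.2])]
  indep := hξ.indep.precomp (g := fun k => (j, k)) fun _ _ h => (Prod.mk.inj h).2

theorem isNearestNeighbour_neg (hξ : IsStepFamily μ p ξ) {j : ℕ} (hp : 1 / 2 < p j ∧ p j < 1) :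
    IsNearestNeighbour μ (p j) (fun k ω => -ξ j k ω) where
  measurable k := (hξ.measurable j k).neg
  down k := by simpa using (hξ.isNearestNeighbour hp).up k
  up k := by
    have := (hξ.isNearestNeighbour hp).down k
    rw [sub_sub_cancel] at this
    rw [← this]
    congr 1
    ext ω
    simp only [Set.mem_ofPred_eq]
    omega
  indep := (hξ.isNearestNeighbour hp).indep.comp (fun _ z => -z) fun _ => measurable_neg

variable [IsProbabilityMeasure μ]

theorem measureReal_hitEver (hξ : IsStepFamily μ p ξ) {j : ℕ} (hp : 1 / 2 < p j ∧ p j < 1)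
    (m : ℕ) : μ.real (hitEver (ξ j) m) = odds p j ^ m := by
  rw [(hξ.isNearestNeighbour hp).measureReal_hitEver (by linarith [hp.2]) (by linarith [hp.1]),
    sub_sub_cancel, odds]

theorem measureReal_noneReaches (hξ : IsStepFamily μ p ξ) (hp : ∀ j, 1 / 2 < p j ∧ p j < 1)
    (s : Finset ℕ) (n : ℕ) :
    μ.real (noneReaches ξ s n) = ∏ j ∈ s, (1 - odds p j ^ (n - j)) := by
  induction s using Finset.induction_on with
  | empty => simp [noneReaches]
  | insert a s ha ih =>
    have : noneReaches ξ (insert a s) n = (hitEver (ξ a) (n - a))ᶜ ∩ noneReaches ξ s n := by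
      simp [noneReaches]
    have hm := measurableSet_frogSigma_hitEver ξ (Set.mem_singleton a) (n - a)
    rw [this, hξ.measureReal_inter (S := {a}) (T := s) (by simpa using ha) hm.compl
      (measurableSet_frogSigma_noneReaches ξ subset_rfl n), ih, Finset.prod_insert ha,
      probReal_compl_eq_one_sub (hξ.frogSigma_le _ _ hm), hξ.measureReal_hitEver (hp a)]

theorem ae_exists_notMem_hitEver (hξ : IsStepFamily μ p ξ) {j : ℕ} (hp : 1 / 2 < p j ∧ p j < 1) :
    ∀ᵐ ω ∂μ, ∃ m, ω ∉ hitEver (ξ j) m := by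
  have h : μ.real {ω | ¬ ∃ m, ω ∉ hitEver (ξ j) m} ≤ 0 := by
    refine ge_of_tendsto' (tendsto_pow_atTop_nhds_zero_of_lt_one (odds_pos hp).le
      (odds_lt_one hp)) fun m => ?_
    rw [← hξ.measureReal_hitEver hp m]
    refine measureReal_mono fun ω hω => ?_
    by_contra hc
    exact hω ⟨m, hc⟩
  have h' := le_antisymm h measureReal_nonneg
  rwa [measureReal_eq_zero_iff] at h'

theorem transient_iff (hξ : IsStepFamily μ p ξ) (hp : ∀ j, 1 / 2 < p j ∧ p j < 1) :
    Transient μ ξ ↔ μ (allReached ξ) = 0 := by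
  constructor
  · intro h
    refine measure_mono_null_ae ?_ h
    have h1 : ∀ᵐ ω ∂μ, ∀ j k, ξ j k ω = -1 ∨ ξ j k ω = 1 :=
      ae_all_iff.mpr fun j => ae_all_iff.mpr (hξ.isNearestNeighbour (hp j)).ae_eq
    have h2 : ∀ᵐ ω ∂μ, ∀ j : ℕ, ω ∈ hitEver (fun k ω => -ξ j k ω) j :=
      ae_all_iff.mpr fun j =>
        (hξ.isNearestNeighbour_neg (hp j)).ae_mem_hitEver (hp j).1.le (hp j).2 j
    filter_upwards [h1, h2] with ω h1 h2 h3
    exact infinite_of_forall_climbs h1 h2 h3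
  · exact measure_mono_null fun ω hω n hn => exists_climbs_of_infinite hω hn

/-- If from some frog on the odds of a right step increase, and the probabilities that a site is
reached by none of these frogs are not summable, then almost surely some frog never wakes up. -/
theorem measure_allReached_eq_zero (hξ : IsStepFamily μ p ξ) (hp : ∀ j, 1 / 2 < p j ∧ p j < 1)
    {N : ℕ} (hmono : ∀ i j, N ≤ i → i ≤ j → odds p i ≤ odds p j)
    (hns : ¬ Summable fun k => ∏ j ∈ Finset.Ico N (N + k), (1 - odds p j ^ (N + k - j))) :
    μ (allReached ξ) = 0 := by
  let G : ℕ → Set Ω := fun k => noneReaches ξ (Finset.Ico N (N + k)) (N + k)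
  have hG : ∀ K, μ (⋂ n ∈ Set.Ici K, (G n)ᶜ) = 0 := by
    refine measure_iInter_compl_eq_zero_of_renewal
      (𝓕 := fun k => frogSigma ξ (Set.Iio (N + k)))
      (fun a b hab => frogSigma_mono ξ (Set.Iio_subset_Iio (by simpa using hab)))
      (fun k => hξ.frogSigma_le _) (fun k => measurableSet_frogSigma_noneReaches ξ
        (fun i hi => (Finset.mem_Ico.mp hi).2) _)
      (fun k => hξ.measureReal_noneReaches hp _ _) (fun m n hmn A hA => ?_) hns
    -- Forgetting the frogs before `N + m` makes the second event independent of `A`. The remaining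
    -- frogs are then compared, at equal distance from the target, with frogs `m` places earlier,
    -- whose odds are no larger.
    have hsub : A ∩ G n ⊆ A ∩ noneReaches ξ (Finset.Ico (N + m) (N + n)) (N + n) :=
      Set.inter_subset_inter_right _ (Set.biInter_subset_biInter_left
        (Finset.coe_subset.mpr (Finset.Ico_subset_Ico_left (by omega))))
    refine (measureReal_mono hsub).trans ?_
    rw [hξ.measureReal_inter (S := Set.Iio (N + m)) (T := Set.Ici (N + m))
      (Set.Iio_disjoint_Ici le_rfl) hA
      (measurableSet_frogSigma_noneReaches ξ (fun i hi => (Finset.mem_Ico.mp hi).1) _),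
      hξ.measureReal_noneReaches hp]
    refine mul_le_mul_of_nonneg_left ?_ measureReal_nonneg
    rw [Finset.prod_Ico_eq_prod_range, Finset.prod_Ico_eq_prod_range,
      show N + n - (N + m) = n - m by omega, show N + (n - m) - N = n - m by omega]
    refine Finset.prod_le_prod (fun i _ => sub_nonneg.mpr
      (pow_le_one₀ (odds_pos (hp _)).le (odds_lt_one (hp _)).le)) fun i hi => ?_
    rw [show N + n - (N + m + i) = N + (n - m) - (N + i) by omega]
    have h1 := hmono (N + i) (N + m + i) (by omega) (by omega)
    have h2 := (odds_pos (hp (N + i))).le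
    gcongr
  have hfin : ∀ᵐ ω ∂μ, ∀ j, ∃ m, ω ∉ hitEver (ξ j) m :=
    ae_all_iff.mpr fun j => hξ.ae_exists_notMem_hitEver (hp j)
  refine measure_mono_null_ae ?_ (measure_iUnion_null hG)
  filter_upwards [hfin] with ω hω hall
  have hev : ∀ᶠ k in atTop, ∀ j ∈ Finset.range N, ω ∉ hitEver (ξ j) (N + k - j) := by
    refine (Filter.eventually_all_finset _).mpr fun j hj => ?_
    obtain ⟨m, hm⟩ := hω j
    filter_upwards [eventually_ge_atTop m] with k hk hmem
    have := Finset.mem_range.mp hj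
    exact hm (hitEver_anti _ (by omega) hmem)
  obtain ⟨K, hK⟩ := eventually_atTop.mp hev
  -- `K + 1` instead of `K` ensures `0 < N + k` even when `N = 0`.
  refine Set.mem_iUnion.mpr ⟨K + 1, Set.mem_iInter₂.mpr fun k hk hmem => ?_⟩
  have hk : K + 1 ≤ k := hk
  obtain ⟨j, hj, hjmem⟩ := hall (N + k) (by omega)
  rcases lt_or_ge j N with h | h
  · exact hK k (by omega) j (Finset.mem_range.mpr h) hjmem
  · exact Set.mem_iInter₂.mp hmem j (Finset.mem_Ico.mpr ⟨h, hj⟩) hjmem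

/-- If the probabilities that site `n` is reached by no frog `1 ≤ j < n` are summable, then with
positive probability all frogs wake up. -/
theorem measure_allReached_ne_zero (hξ : IsStepFamily μ p ξ) (hp : ∀ j, 1 / 2 < p j ∧ p j < 1)
    (hs : Summable fun n => ∏ j ∈ Finset.Ico 1 n, (1 - odds p j ^ (n - j))) :
    μ (allReached ξ) ≠ 0 := by
  -- Frog `0` is left out so that its climb to `N` is independent of these events.
  let G : ℕ → Set Ω := fun n => noneReaches ξ (Finset.Ico 1 n) n
  let u : ℕ → ℝ := fun n => ∏ j ∈ Finset.Ico 1 n, (1 - odds p j ^ (n - j))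
  have hu : ∀ n, μ.real (G n) = u n := fun n => hξ.measureReal_noneReaches hp _ _
  obtain ⟨N, hN⟩ := ((tendsto_sum_nat_add u).eventually_lt_const one_pos).exists
  have hsN : Summable fun k => u (k + N) := (summable_nat_add_iff N).mpr hs
  let E : Set Ω := ⋃ k, G (k + N)
  have hGm : ∀ n, MeasurableSet[frogSigma ξ (Set.Ici 1)] (G n) := fun n =>
    measurableSet_frogSigma_noneReaches ξ (fun i hi => (Finset.mem_Ico.mp hi).1) _
  have hEm : MeasurableSet[frogSigma ξ (Set.Ici 1)] E := .iUnion fun k => hGm _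
  have hE : μ.real E < 1 := by
    have h1 : μ E ≤ ENNReal.ofReal (∑' k, u (k + N)) := by
      rw [ENNReal.ofReal_tsum_of_nonneg (fun k => hu _ ▸ measureReal_nonneg) hsN]
      refine (measure_iUnion_le _).trans (ENNReal.tsum_le_tsum fun k => ?_)
      rw [← hu, ofReal_measureReal]
    calc μ.real E ≤ ∑' k, u (k + N) :=
          ENNReal.toReal_le_of_le_ofReal (tsum_nonneg fun k => hu _ ▸ measureReal_nonneg) h1
      _ < 1 := hN
  have hsub : hitEver (ξ 0) N ∩ Eᶜ ⊆ allReached ξ := by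
    rintro ω ⟨h0, hEc⟩ n hn
    rcases lt_or_ge n N with h | h
    · exact ⟨0, hn, hitEver_anti _ (by omega) h0⟩
    · have hGn : ω ∉ G n := fun hG =>
        hEc (Set.mem_iUnion.mpr ⟨n - N, (Nat.sub_add_cancel h).symm ▸ hG⟩)
      simp only [G, noneReaches, Set.mem_iInter, not_forall, Set.notMem_compl_iff] at hGn
      obtain ⟨j, hj, hmem⟩ := hGn
      exact ⟨j, (Finset.mem_Ico.mp hj).2, hmem⟩
  intro h0
  have hz : μ.real (hitEver (ξ 0) N ∩ Eᶜ) = 0 :=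
    (measureReal_eq_zero_iff (measure_ne_top _ _)).mpr (measure_mono_null hsub h0)
  have hd : Disjoint ({0} : Set ℕ) (Set.Ici 1) := by simp
  rw [hξ.measureReal_inter hd
    (measurableSet_frogSigma_hitEver ξ (Set.mem_singleton 0) N) hEm.compl, hξ.measureReal_hitEver (hp 0),
    probReal_compl_eq_one_sub (hξ.frogSigma_le _ _ hEm)] at hz
  have := mul_pos (pow_pos (odds_pos (hp 0)) N) (sub_pos.mpr hE)
  linarith

end IsStepFamily

/-! ### Asymptotics of the probability that a site is not reached -/

theorem two_mul_le_log_sub_log {y : ℝ} (h0 : 0 ≤ y) (h1 : y < 1) :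
    2 * y ≤ Real.log (1 + y) - Real.log (1 - y) := by
  have h := sum_le_hasSum {0} (fun k _ => by positivity)
    (Real.hasSum_log_sub_log_of_abs_lt_one (x := y) (by rwa [abs_of_nonneg h0]))
  simpa using h

/-- With `y = 2 * p j - 1` the odds are `(1 - y) / (1 + y)`, and `log ((1 + y) / (1 - y)) ≥ 2 * y`.
-/
theorem odds_le_exp {p : ℕ → ℝ} {j : ℕ} (hp : 1 / 2 < p j ∧ p j < 1) :
    odds p j ≤ Real.exp (-(4 * (p j - 1 / 2))) := by
  have h := two_mul_le_log_sub_log (y := 2 * p j - 1) (by linarith [hp.1]) (by linarith [hp.2])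
  rw [← Real.log_le_iff_le_exp (odds_pos hp), odds, Real.log_div (by linarith [hp.2])
    (by linarith [hp.1])]
  rw [show 1 + (2 * p j - 1) = 2 * p j by ring, show 1 - (2 * p j - 1) = 2 * (1 - p j) by ring,
    Real.log_mul two_ne_zero (by linarith [hp.1]),
    Real.log_mul two_ne_zero (by linarith [hp.2])] at h
  linarith

theorem odds_le_odds {p : ℕ → ℝ} {i j : ℕ} (hi : 1 / 2 < p i ∧ p i < 1)
    (hj : 1 / 2 < p j ∧ p j < 1) (h : p j ≤ p i) : odds p i ≤ odds p j := by
  have := hi.1; have := hj.1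
  rw [odds, odds, div_le_div_iff₀ (by linarith) (by linarith)]
  nlinarith

theorem prod_Ico_one_sub_pow {r : ℝ} (h0 : 0 < r) (h1 : r < 1) (a n : ℕ) :
    ∏ j ∈ Finset.Ico a n, (1 - r ^ (n - j)) =
      Real.exp (-∑ m ∈ Finset.range (n - a), -Real.log (1 - r ^ (m + 1))) := by
  rw [Finset.prod_Ico_eq_prod_range, ← Finset.prod_range_reflect, Finset.sum_neg_distrib, neg_neg,
    Real.exp_sum]
  refine Finset.prod_congr rfl fun m hm => ?_
  have hm' := Finset.mem_range.mp hm
  rw [Real.exp_log (sub_pos.mpr (pow_lt_one₀ h0.le h1 m.succ_ne_zero)),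
    show n - (a + (n - a - 1 - m)) = m + 1 by omega]

theorem tendsto_div_log_atTop : Tendsto (fun x : ℝ => x / Real.log x) atTop atTop := by
  have h := Real.isLittleO_log_id_atTop.tendsto_div_nhds_zero
  have h' : Tendsto (fun x : ℝ => Real.log x / x) atTop (𝓝[>] 0) := by
    refine tendsto_nhdsWithin_iff.mpr ⟨h, ?_⟩
    filter_upwards [eventually_gt_atTop 1] with x hx
    exact div_pos (Real.log_pos hx) (by linarith)
  exact (tendsto_inv_nhdsGT_zero.comp h').congr fun x => by simp

/-! ### The drift `C / log n` and the summability threshold -/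

section LogDrift

variable {p : ℕ → ℝ} {C : ℝ}

theorem pos_of_eventually_eq (hp : ∀ j, 1 / 2 < p j ∧ p j < 1)
    (hC : ∀ᶠ n : ℕ in atTop, p n = 1 / 2 + C / Real.log n) : 0 < C := by
  obtain ⟨n, hn, hn2⟩ := (hC.and (eventually_ge_atTop 2)).exists
  have hlog : 0 < Real.log n := Real.log_pos (by exact_mod_cast hn2)
  have h : 0 < C / Real.log n := by linarith [(hp n).1]
  exact (div_pos_iff_of_pos_right hlog).mp h

theorem exists_forall_eq (hC : ∀ᶠ n : ℕ in atTop, p n = 1 / 2 + C / Real.log n) :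
    ∃ N, 2 ≤ N ∧ ∀ n, N ≤ n → p n = 1 / 2 + C / Real.log n := by
  obtain ⟨N, hN⟩ := eventually_atTop.mp (hC.and (eventually_ge_atTop 2))
  exact ⟨N, (hN N le_rfl).2, fun n hn => (hN n hn).1⟩

theorem odds_mono_of_eq (hp : ∀ j, 1 / 2 < p j ∧ p j < 1) (hC0 : 0 < C) {N : ℕ} (hN2 : 2 ≤ N)
    (hN : ∀ n, N ≤ n → p n = 1 / 2 + C / Real.log n) (i j : ℕ) (hi : N ≤ i) (hij : i ≤ j) :
    odds p i ≤ odds p j := by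
  refine odds_le_odds (hp i) (hp j) ?_
  have hi1 : (1 : ℝ) < i := by exact_mod_cast (by omega : 1 < i)
  have hlog : 0 < Real.log i := Real.log_pos hi1
  have hle : Real.log i ≤ Real.log j := Real.log_le_log (by linarith) (by exact_mod_cast hij)
  rw [hN i hi, hN j (hi.trans hij)]
  gcongr

theorem not_summable_prod_one_sub_odds (hp : ∀ j, 1 / 2 < p j ∧ p j < 1) (hC0 : 0 < C)
    (hC24 : Real.pi ^ 2 / 24 ≤ C) {N : ℕ} (hN2 : 2 ≤ N)
    (hN : ∀ n, N ≤ n → p n = 1 / 2 + C / Real.log n) :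
    ¬ Summable fun k => ∏ j ∈ Finset.Ico N (N + k), (1 - odds p j ^ (N + k - j)) := by
  intro hs
  refine Real.not_summable_one_div_natCast ((summable_nat_add_iff N).mp
    (hs.of_nonneg_of_le (fun k => by positivity) fun k => ?_))
  set n := N + k with hn
  have hn1 : (1 : ℝ) < n := by exact_mod_cast (by omega : 1 < n)
  have hlog : 0 < Real.log n := Real.log_pos hn1
  -- Since `log j ≤ log n`, every frog `N ≤ j < n` has odds at most `exp (-a)`, so the product is at
  -- least the one with constant odds.
  set a := 4 * C / Real.log n with ha
  have ha0 : 0 < a := by positivity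
  have hsum := sum_neg_log_one_sub_pow_le ha0 (n - N)
  have hle : Real.pi ^ 2 / (6 * a) ≤ Real.log n := by
    rw [div_le_iff₀ (by positivity), ha]
    calc Real.pi ^ 2 ≤ 24 * C := by linarith
      _ = Real.log n * (6 * (4 * C / Real.log n)) := by field_simp; ring
  calc 1 / ((k + N : ℕ) : ℝ) = Real.exp (-Real.log n) := by
        rw [Real.exp_neg, Real.exp_log (by linarith), one_div, add_comm k N]
    _ ≤ Real.exp (-∑ m ∈ Finset.range (n - N), -Real.log (1 - Real.exp (-a) ^ (m + 1))) :=
        Real.exp_le_exp.mpr (by linarith)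
    _ = ∏ j ∈ Finset.Ico N n, (1 - Real.exp (-a) ^ (n - j)) :=
        (prod_Ico_one_sub_pow (Real.exp_pos _) (by simpa using ha0) N n).symm
    _ ≤ ∏ j ∈ Finset.Ico N n, (1 - odds p j ^ (n - j)) := by
        refine Finset.prod_le_prod (fun j _ => sub_nonneg.mpr
          (pow_le_one₀ (Real.exp_pos _).le (by simpa using ha0.le))) fun j hj => ?_
        obtain ⟨hj1, hj2⟩ := Finset.mem_Ico.mp hj
        have h1 : odds p j ≤ Real.exp (-a) := by
          refine (odds_le_exp (hp j)).trans (Real.exp_le_exp.mpr (neg_le_neg ?_))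
          have hj' : (1 : ℝ) < j := by exact_mod_cast (by omega : 1 < j)
          have hlogj : 0 < Real.log j := Real.log_pos hj'
          have hlogle : Real.log j ≤ Real.log n :=
            Real.log_le_log (by linarith) (by exact_mod_cast hj2.le)
          rw [hN j hj1, add_sub_cancel_left, ha, mul_div_assoc]
          gcongr
        have h2 := (odds_pos (hp j)).le
        gcongr

theorem tendsto_odds (hC : ∀ᶠ n : ℕ in atTop, p n = 1 / 2 + C / Real.log n) :
    Tendsto (odds p) atTop (𝓝 1) := by
  have h1 : Tendsto (fun n : ℕ => 1 / 2 + C / Real.log n) atTop (𝓝 (1 / 2 + 0)) :=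
    ((Real.tendsto_log_atTop.comp tendsto_natCast_atTop_atTop).const_div_atTop C).const_add _
  have h2 : Tendsto p atTop (𝓝 (1 / 2 + 0)) := h1.congr' (hC.mono fun n hn => hn.symm)
  have h3 := (h2.const_sub 1).div h2 (by norm_num)
  norm_num at h3
  exact h3

theorem tendsto_half_atTop : Tendsto (fun n : ℕ => n - n / 2) atTop atTop :=
  tendsto_atTop.mpr fun b => (eventually_ge_atTop (2 * b)).mono fun n hn => by omega

theorem tendsto_odds_half_pow (hp : ∀ j, 1 / 2 < p j ∧ p j < 1)
    (hC : ∀ᶠ n : ℕ in atTop, p n = 1 / 2 + C / Real.log n) :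
    Tendsto (fun n : ℕ => odds p (n - n / 2) ^ (n / 2)) atTop (𝓝 0) := by
  have hC0 := pos_of_eventually_eq hp hC
  have h1 : Tendsto (fun j : ℕ => Real.exp (-(2 * C * ((j : ℝ) / Real.log j)))) atTop (𝓝 0) :=
    Real.tendsto_exp_neg_atTop_nhds_zero.comp ((tendsto_div_log_atTop.comp
      tendsto_natCast_atTop_atTop).const_mul_atTop (by positivity))
  refine squeeze_zero' (.of_forall fun n => pow_nonneg (odds_pos (hp _)).le _) ?_
    (h1.comp tendsto_half_atTop)
  filter_upwards [tendsto_half_atTop.eventually hC, tendsto_half_atTop.eventually_ge_atTop 2]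
    with n hn hn2
  have h2 := odds_le_exp (hp (n - n / 2))
  rw [hn, add_sub_cancel_left] at h2
  have hlog : 0 < Real.log (n - n / 2 : ℕ) := Real.log_pos (by exact_mod_cast hn2)
  have hM : ((n - n / 2 : ℕ) : ℝ) ≤ 2 * (n / 2 : ℕ) := by
    exact_mod_cast (by omega : n - n / 2 ≤ 2 * (n / 2))
  calc odds p (n - n / 2) ^ (n / 2)
      ≤ Real.exp (-(4 * (C / Real.log (n - n / 2 : ℕ)))) ^ (n / 2) :=
        pow_le_pow_left₀ (odds_pos (hp _)).le h2 _
    _ = Real.exp (-(2 * C * (2 * (n / 2 : ℕ) / Real.log (n - n / 2 : ℕ)))) := by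
        rw [← Real.exp_nat_mul]; congr 1; ring
    _ ≤ Real.exp (-(2 * C * ((n - n / 2 : ℕ) / Real.log (n - n / 2 : ℕ)))) := by
        gcongr

theorem tendsto_log_half_div_log :
    Tendsto (fun n : ℕ => Real.log (n - n / 2 : ℕ) / Real.log n) atTop (𝓝 1) := by
  have hlog : Tendsto (fun n : ℕ => Real.log n) atTop atTop :=
    Real.tendsto_log_atTop.comp tendsto_natCast_atTop_atTop
  have h1 : Tendsto (fun n : ℕ => 1 - Real.log 2 / Real.log n) atTop (𝓝 (1 - 0)) :=
    (hlog.const_div_atTop _).const_sub 1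
  rw [sub_zero] at h1
  refine tendsto_of_tendsto_of_tendsto_of_le_of_le' h1 tendsto_const_nhds ?_ ?_
  · filter_upwards [eventually_ge_atTop 2] with n hn
    have hn1 : (1 : ℝ) < n := by exact_mod_cast hn
    have hl : 0 < Real.log n := Real.log_pos hn1
    have hj : (0 : ℝ) < (n - n / 2 : ℕ) := by exact_mod_cast (by omega : 0 < n - n / 2)
    have hle : (n : ℝ) ≤ 2 * (n - n / 2 : ℕ) := by
      exact_mod_cast (by omega : n ≤ 2 * (n - n / 2))
    have h2 := Real.log_le_log (by linarith) hle
    rw [Real.log_mul two_ne_zero hj.ne'] at h2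
    rw [le_div_iff₀ hl, sub_mul, div_mul_cancel₀ _ hl.ne']
    linarith
  · filter_upwards [eventually_ge_atTop 2] with n hn
    have hn1 : (1 : ℝ) < n := by exact_mod_cast hn
    have hj : (0 : ℝ) < (n - n / 2 : ℕ) := by exact_mod_cast (by omega : 0 < n - n / 2)
    exact div_le_one_of_le₀ (Real.log_le_log hj (by exact_mod_cast Nat.sub_le _ _))
      (Real.log_pos hn1).le

/-- The frogs in `[n - n / 2, n)` suffice: their odds are at least those of the first of them, and
`log (n - n / 2)` is asymptotic to `log n`. -/
theorem summable_prod_one_sub_odds (hp : ∀ j, 1 / 2 < p j ∧ p j < 1)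
    (hC : ∀ᶠ n : ℕ in atTop, p n = 1 / 2 + C / Real.log n) (hC24 : C < Real.pi ^ 2 / 24) :
    Summable fun n => ∏ j ∈ Finset.Ico 1 n, (1 - odds p j ^ (n - j)) := by
  have hC0 := pos_of_eventually_eq hp hC
  obtain ⟨N, hN2, hN⟩ := exists_forall_eq hC
  have hmono := odds_mono_of_eq hp hC0 hN2 hN
  obtain ⟨K, hK⟩ := (hasSum_one_div_succ_sq.tendsto_sum_nat.eventually_const_lt
    (show 4 * C < Real.pi ^ 2 / 6 by linarith)).exists
  set S := ∑ k ∈ Finset.range K, 1 / ((k : ℝ) + 1) ^ 2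
  -- The room between `1` and `S / (4 * C)` absorbs the factors tending to `1`; the product is
  -- eventually at most `n ^ (-c)` with `c > 1`.
  obtain ⟨c, hc1, hcs⟩ := exists_between ((one_lt_div (by positivity)).mpr hK)
  have hs0 : 0 < S / (4 * C) := by linarith
  have hlim : Tendsto (fun n : ℕ => odds p (n - n / 2) ^ K *
      (1 - odds p (n - n / 2) ^ (n / 2)) * (Real.log (n - n / 2 : ℕ) / Real.log n)) atTop
      (𝓝 (1 ^ K * (1 - 0) * 1)) :=
    ((((tendsto_odds hC).comp tendsto_half_atTop).pow K).mul
      ((tendsto_odds_half_pow hp hC).const_sub 1)).mul tendsto_log_half_div_log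
  have hclt : c / (S / (4 * C)) < 1 ^ K * (1 - 0) * 1 := by
    rw [div_lt_iff₀ hs0]; simpa using hcs
  refine Summable.of_norm_bounded_eventually_nat
    (Real.summable_nat_rpow.mpr (neg_lt_neg hc1)) ?_
  have hfac : ∀ j m, 0 ≤ 1 - odds p j ^ m ∧ 1 - odds p j ^ m ≤ 1 := fun j m =>
    ⟨sub_nonneg.mpr (pow_le_one₀ (odds_pos (hp j)).le (odds_lt_one (hp j)).le),
      sub_le_self _ (pow_nonneg (odds_pos (hp j)).le m)⟩
  filter_upwards [hlim.eventually_const_lt hclt, tendsto_half_atTop.eventually_ge_atTop N]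
    with n hn hnN
  rw [Real.norm_of_nonneg (Finset.prod_nonneg fun j _ => (hfac j _).1)]
  have hsubn : n - (n - n / 2) = n / 2 := by omega
  set j := n - n / 2 with hj
  set r := odds p j with hr
  have hr0 : 0 < r := odds_pos (hp j)
  have hr1 : r < 1 := odds_lt_one (hp j)
  have hlogj : 0 < Real.log j := Real.log_pos (by exact_mod_cast (by omega : 1 < j))
  have hn1 : (1 : ℝ) < n := by exact_mod_cast (by omega : 1 < n)
  have hlogn : 0 < Real.log n := Real.log_pos hn1
  -- `1 - r = (2 * p j - 1) / p j`, and `p j > 1 / 2`.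
  have h1r : 1 - r ≤ 4 * C / Real.log j := by
    have hpj := (hp j).1
    have h4 : 2 * (p j - 1 / 2) * 2 = 4 * C / Real.log j := by
      rw [hN j hnN, add_sub_cancel_left]; ring
    rw [hr, odds, one_sub_div (by linarith), div_le_iff₀ (by linarith), ← h4]
    nlinarith
  have hA : 0 ≤ r ^ K * (1 - r ^ (n / 2)) := mul_nonneg (by positivity) (hfac j _).1
  have hmain : c * Real.log n ≤
      ∑ m ∈ Finset.range (n / 2), -Real.log (1 - r ^ (m + 1)) := by
    refine le_trans ?_ (le_sum_neg_log_one_sub_pow hr0 hr1 K (n / 2))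
    rw [div_lt_iff₀ hs0] at hn
    calc c * Real.log n
        ≤ r ^ K * (1 - r ^ (n / 2)) * (Real.log j / Real.log n) * (S / (4 * C)) * Real.log n := by
          gcongr
      _ = r ^ K * (1 - r ^ (n / 2)) / (4 * C / Real.log j) * S := by field_simp
      _ ≤ r ^ K * (1 - r ^ (n / 2)) / (1 - r) * S := by
          have : 0 < 1 - r := by linarith
          have hS0 : 0 ≤ S := Finset.sum_nonneg fun k _ => by positivity
          gcongr
  have hsub : Finset.Ico j n ⊆ Finset.Ico 1 n := Finset.Ico_subset_Ico_left (by omega)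
  calc ∏ i ∈ Finset.Ico 1 n, (1 - odds p i ^ (n - i))
      ≤ ∏ i ∈ Finset.Ico j n, (1 - odds p i ^ (n - i)) := by
        rw [← Finset.prod_sdiff hsub]
        exact mul_le_of_le_one_left (Finset.prod_nonneg fun i _ => (hfac i _).1)
          (Finset.prod_le_one (fun i _ => (hfac i _).1) fun i _ => (hfac i _).2)
    _ ≤ ∏ i ∈ Finset.Ico j n, (1 - r ^ (n - i)) := by
        refine Finset.prod_le_prod (fun i _ => (hfac i _).1) fun i hi => ?_
        have := hmono j i hnN (Finset.mem_Ico.mp hi).1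
        gcongr
    _ = Real.exp (-∑ m ∈ Finset.range (n / 2), -Real.log (1 - r ^ (m + 1))) := by
        rw [prod_Ico_one_sub_pow hr0 hr1, hsubn]
    _ ≤ Real.exp (-(c * Real.log n)) := Real.exp_le_exp.mpr (neg_le_neg hmain)
    _ = (n : ℝ) ^ (-c) := by
        rw [Real.rpow_def_of_pos (by linarith)]; congr 1; ring

end LogDrift

end Frog

theorem mainTheorem5 {Ω : Type*} [MeasurableSpace Ω] (μ : MeasureTheory.Measure Ω)
    [MeasureTheory.IsProbabilityMeasure μ] (p : ℕ → ℝ) (ξ : ℕ → ℕ → Ω → ℤ) (C : ℝ)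
    (hp : ∀ j, 1 / 2 < p j ∧ p j < 1)
    (hC : ∀ᶠ n : ℕ in Filter.atTop, p n = 1 / 2 + C / Real.log (n : ℝ))
    (hξ : Frog.IsStepFamily μ p ξ) :
    (MeasureTheory.IntegrableOn (fun x : ℝ => |Real.log (1 - Real.exp (-x))|) (Set.Ioi 0) ∧
      ∫ x in Set.Ioi (0 : ℝ), |Real.log (1 - Real.exp (-x))| = Real.pi ^ 2 / 6) ∧
    (Frog.Transient μ ξ ↔ Real.pi ^ 2 / 24 ≤ C) := by
  refine ⟨⟨Frog.integrableOn_abs_log_one_sub_exp_neg, Frog.integral_abs_log_one_sub_exp_neg⟩, ?_⟩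
  rw [hξ.transient_iff hp]
  refine ⟨fun h => ?_, fun h => ?_⟩
  · by_contra! hlt
    exact hξ.measure_allReached_ne_zero hp (Frog.summable_prod_one_sub_odds hp hC hlt) h
  · have hC0 := Frog.pos_of_eventually_eq hp hC
    obtain ⟨N, hN2, hN⟩ := Frog.exists_forall_eq hC
    exact hξ.measure_allReached_eq_zero hp (Frog.odds_mono_of_eq hp hC0 hN2 hN)
      (Frog.not_summable_prod_one_sub_odds hp hC0 h hN2 hN)
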